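/- Let $(R,\mathfrak m)$ be a Noetherian local ring of prime characteristic $p>0$ and let $x\in\mathfrak m$ be a non-zero-divisor. For an ideal $I$ of a ring $A$, an $A$-module $M$ and $i\ge 0$, write $H^i_I(M)=\varinjlim_t \operatorname{Ext}^i_A(A/I^t,M)$ for local cohomology. For a ring $A$ of characteristic $p$, let $F_*A$ denote $A$ regarded as an $A$-module through the Frobenius $a\mapsto a^p$. A Noetherian local ring $(A,\mathfrak n)$ of characteristic $p$ is called $F$-injective if for every $i\ge 0$ the Frobenius action on $H^i_{\mathfrak n}(A)$, that is, the map $H^i_{\mathfrak n}(A)\to H^i_{\mathfrak n}(F_*A)\cong F_*H^i_{\mathfrak n}(A)$ induced by the $A$-linear Frobenius map $A\to F_*A$, is injective. Suppose that the local ring $R/xR$ is $F$-injective and that $x$ is a surjective element, i.e. for all $\ell>0$ and all $i\ge 0$ the map $H^i_{\mathfrak m}(R/x^\ell R)\to H^i_{\mathfrak m}(R/xR)$ induced by the natural surjection $R/x^\ell R\to R/xR$ is surjective. Then $R$ is $F$-injective. -/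

import Mathlib

open CategoryTheory IsLocalRing

universe u

namespace FInj

/-- The Frobenius pushforward `F_* M` of a module `M` over a ring `R` of prime characteristic `p`:
the abelian group `M` on which `r` acts as multiplication by `r ^ p`. -/
noncomputable abbrev frobeniusPushforward {R : Type u} [CommRing R] (p : ℕ) [Fact p.Prime]
    [CharP R p] (M : ModuleCat.{u} R) : ModuleCat.{u} R :=
  (ModuleCat.restrictScalars (frobenius R p)).obj M

/-- The Frobenius map `r ↦ r ^ p`, as an `R`-linear map `R → F_* R`. -/
noncomputable def frobeniusHom (R : Type u) [CommRing R] (p : ℕ) [Fact p.Prime] [CharP R p] :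
    ModuleCat.of R R ⟶ frobeniusPushforward p (ModuleCat.of R R) :=
  ModuleCat.ofHom (Y := frobeniusPushforward p (ModuleCat.of R R))
    { toFun := fun r => (frobenius R p r : R)
      map_add' := fun a b => map_add (frobenius R p) a b
      map_smul' := fun a b => map_mul (frobenius R p) a b }

/-- A local ring `(R, m)` of prime characteristic `p` is `F`-injective if for every `i ≥ 0` the
map `H^i_m(R) → H^i_m(F_* R) ≅ F_* H^i_m(R)` induced by the Frobenius `R → F_* R` is injective. -/
def IsFInjective (R : Type u) [CommRing R] [IsLocalRing R] (p : ℕ) [Fact p.Prime] [CharP R p] :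
    Prop :=
  ∀ i : ℕ, Function.Injective ((localCohomology (maximalIdeal R) i).map (frobeniusHom R p))

/-- The natural surjection `R / x ^ ℓ R → R / x R` for `ℓ > 0`, as a map of `R`-modules. -/
noncomputable def quotientPowHom {R : Type u} [CommRing R] (x : R) {ℓ : ℕ} (hℓ : 0 < ℓ) :
    ModuleCat.of R (R ⧸ Ideal.span {x ^ ℓ}) ⟶ ModuleCat.of R (R ⧸ Ideal.span {x}) :=
  ModuleCat.ofHom (Submodule.factor
    ((Ideal.span_singleton_le_span_singleton).2 (dvd_pow_self x hℓ.ne')))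

section quotient

variable {R : Type u} [CommRing R] [IsLocalRing R] {x : R}

theorem nontrivial_quotient (hx : x ∈ maximalIdeal R) : Nontrivial (R ⧸ Ideal.span {x}) :=
  Ideal.Quotient.nontrivial_iff.2 fun h =>
    (mem_maximalIdeal x).1 hx (Ideal.span_singleton_eq_top.1 h)

theorem isLocalRing_quotient (hx : x ∈ maximalIdeal R) : IsLocalRing (R ⧸ Ideal.span {x}) :=
  haveI := nontrivial_quotient hx
  .of_surjective' (Ideal.Quotient.mk _) Ideal.Quotient.mk_surjective

theorem charP_quotient (p : ℕ) [Fact p.Prime] [CharP R p] (hx : x ∈ maximalIdeal R) :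
    CharP (R ⧸ Ideal.span {x}) p :=
  haveI := nontrivial_quotient hx
  (CharP.charP_iff_prime_eq_zero Fact.out).2 <| by
    rw [← map_natCast (Ideal.Quotient.mk (Ideal.span {x})) p, CharP.cast_eq_zero, map_zero]

end quotient

end FInj

/-!
Let `S` be the sequence `0 → R → R → R / x R → 0` given by multiplication by `x`. The Frobenius
maps `S` to `F_* S`, twisted by `x ^ (p - 1)` on the first term, and so acts on the long exact
sequence of local cohomology. Surjectivity of `x` makes the maps `Hⁱ(R / x R) → Hⁱ(R / x ^ t R)`
given by `x ^ (t - 1)` injective, and hence so are the connecting maps `δ` of `F_* S`. A class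
killed by `x` and by the Frobenius is `δ ξ` with `δ (F ξ) = 0`, so `ξ = 0` by `F`-injectivity of
`R / x R`. Since every class is killed by a power of `x`, the Frobenius is injective.

Local cohomology over `R / x R`, and over `R` acting through the Frobenius, is compared with local
cohomology over `R`: both sides are effaceable cohomological functors which agree in degree `0`.
-/

open Limits Opposite

universe v₁ v₂ u₁ u₂

/-- A cohomological `δ`-functor between abelian categories, starting in degree `0`. -/
structure CohomologicalFunctor (C : Type u₁) [Category.{v₁} C] [Abelian C]
    (D : Type u₂) [Category.{v₂} D] [Abelian D] where
  /-- the functor in each degree -/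
  T : ℕ → C ⥤ D
  /-- the connecting morphisms -/
  δ : ∀ {S : ShortComplex C}, S.ShortExact → ∀ n, (T n).obj S.X₃ ⟶ (T (n + 1)).obj S.X₁
  δ_naturality : ∀ {S S' : ShortComplex C} (hS : S.ShortExact) (hS' : S'.ShortExact)
    (φ : S ⟶ S') (n : ℕ), δ hS n ≫ (T (n + 1)).map φ.τ₁ = (T n).map φ.τ₃ ≫ δ hS' n
  map_comp_zero : ∀ {S : ShortComplex C}, S.ShortExact → ∀ n,
    (T n).map S.f ≫ (T n).map S.g = 0
  comp_δ : ∀ {S : ShortComplex C} (hS : S.ShortExact) (n : ℕ), (T n).map S.g ≫ δ hS n = 0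
  δ_comp : ∀ {S : ShortComplex C} (hS : S.ShortExact) (n : ℕ),
    δ hS n ≫ (T (n + 1)).map S.f = 0
  exact₂ : ∀ {S : ShortComplex C} (hS : S.ShortExact) (n : ℕ),
    (ShortComplex.mk _ _ (map_comp_zero hS n)).Exact
  exact₃ : ∀ {S : ShortComplex C} (hS : S.ShortExact) (n : ℕ),
    (ShortComplex.mk _ _ (comp_δ hS n)).Exact
  exact₁ : ∀ {S : ShortComplex C} (hS : S.ShortExact) (n : ℕ),
    (ShortComplex.mk _ _ (δ_comp hS n)).Exact
  mono_zero : ∀ {S : ShortComplex C}, S.ShortExact → Mono ((T 0).map S.f)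

namespace CohomologicalFunctor

section Comparison

variable {C : Type u₁} [Category.{v₁} C] [Abelian C] {D : Type u₂} [Category.{v₂} D] [Abelian D]

/-- A cohomological functor is effaceable if it vanishes on injectives in positive degrees. -/
def Effaceable (T : CohomologicalFunctor C D) : Prop :=
  ∀ (n : ℕ) (E : C), Injective E → IsZero ((T.T (n + 1)).obj E)

variable [EnoughInjectives C]

/-- The short complex `M ⟶ E ⟶ E / M` with `E` an injective object containing `M`. -/
noncomputable abbrev injSeq (M : C) : ShortComplex C :=
  ShortComplex.mk (Injective.ι M) (cokernel.π (Injective.ι M)) (cokernel.condition _)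

theorem injSeq_shortExact (M : C) : (injSeq M).ShortExact where
  exact := ShortComplex.exact_of_g_is_cokernel _ (cokernelIsCokernel _)

theorem exists_injSeq_map {M N : C} (f : M ⟶ N) :
    ∃ φ : injSeq M ⟶ injSeq N, φ.τ₁ = f := by
  let g := Injective.factorThru (f ≫ Injective.ι N) (Injective.ι M)
  have hg : Injective.ι M ≫ g = f ≫ Injective.ι N := Injective.comp_factorThru _ _
  exact ⟨{ τ₁ := f, τ₂ := g, τ₃ := cokernel.map _ _ f g hg
           comm₁₂ := hg.symm, comm₂₃ := by simp }, rfl⟩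

variable {T S : CohomologicalFunctor C D}

theorem Effaceable.epi_δ (hT : T.Effaceable) (M : C) (n : ℕ) :
    Epi (T.δ (injSeq_shortExact M) n) :=
  (T.exact₁ (injSeq_shortExact M) n).epi_f ((hT n _ inferInstance).eq_of_tgt _ _)

theorem exists_map_succ (hT : T.Effaceable) (n : ℕ) (e : T.T n ⟶ S.T n) (M : C) :
    ∃ g : (T.T (n + 1)).obj M ⟶ (S.T (n + 1)).obj M,
      T.δ (injSeq_shortExact M) n ≫ g = e.app _ ≫ S.δ (injSeq_shortExact M) n := by
  have := hT.epi_δ M n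
  refine ⟨(T.exact₃ (injSeq_shortExact M) n).desc
    (e.app _ ≫ S.δ (injSeq_shortExact M) n) ?_, ?_⟩
  · dsimp only
    rw [e.naturality_assoc]
    exact (congrArg (e.app _ ≫ ·) (S.comp_δ (injSeq_shortExact M) n)).trans comp_zero
  · exact (T.exact₃ (injSeq_shortExact M) n).g_desc _ _

/-- The map in degree `n + 1` induced by a natural transformation in degree `n`. -/
noncomputable def natTransSucc (hT : T.Effaceable) (n : ℕ) (e : T.T n ⟶ S.T n) :
    T.T (n + 1) ⟶ S.T (n + 1) where
  app M := (exists_map_succ hT n e M).choose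
  naturality M N f := by
    obtain ⟨φ, rfl⟩ := exists_injSeq_map f
    have := hT.epi_δ M n
    rw [← cancel_epi (T.δ (injSeq_shortExact M) n)]
    have h := T.δ_naturality (injSeq_shortExact M) (injSeq_shortExact N) φ n
    have h' := S.δ_naturality (injSeq_shortExact M) (injSeq_shortExact N) φ n
    rw [reassoc_of% h, (exists_map_succ hT n e N).choose_spec, e.naturality_assoc, ← h',
      reassoc_of% (exists_map_succ hT n e M).choose_spec]

theorem δ_natTransSucc (hT : T.Effaceable) (n : ℕ) (e : T.T n ⟶ S.T n) (M : C) :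
    T.δ (injSeq_shortExact M) n ≫ (natTransSucc hT n e).app M =
      e.app _ ≫ S.δ (injSeq_shortExact M) n :=
  (exists_map_succ hT n e M).choose_spec

theorem natTransSucc_comp_eq_id (hT : T.Effaceable) (hS : S.Effaceable) (n : ℕ)
    (e : T.T n ≅ S.T n) :
    natTransSucc hT n e.hom ≫ natTransSucc hS n e.inv = 𝟙 _ := by
  ext M
  have := hT.epi_δ M n
  rw [← cancel_epi (T.δ (injSeq_shortExact M) n), NatTrans.comp_app,
    reassoc_of% δ_natTransSucc hT n e.hom M, δ_natTransSucc, NatTrans.id_app]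
  simp

theorem Effaceable.nonempty_iso (hT : T.Effaceable) (hS : S.Effaceable)
    (e : T.T 0 ≅ S.T 0) (n : ℕ) : Nonempty (T.T n ≅ S.T n) := by
  induction n with
  | zero => exact ⟨e⟩
  | succ n ih =>
    obtain ⟨e⟩ := ih
    exact ⟨⟨natTransSucc hT n e.hom, natTransSucc hS n e.inv,
      natTransSucc_comp_eq_id hT hS n e, natTransSucc_comp_eq_id hS hT n e.symm⟩⟩

end Comparison

section Constructions

variable {C : Type u₁} [Category.{v₁} C] [Abelian C] {D : Type u₂} [Category.{v₂} D] [Abelian D]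

universe v₃ u₃

variable {C' : Type u₃} [Category.{v₃} C'] [Abelian C']

/-- Precomposition of a cohomological functor with an exact functor. -/
def precomp (F : C' ⥤ C) [F.Additive] [PreservesFiniteLimits F] [PreservesFiniteColimits F]
    (T : CohomologicalFunctor C D) : CohomologicalFunctor C' D where
  T n := F ⋙ T.T n
  δ hS n := T.δ (hS.map_of_exact F) n
  δ_naturality hS hS' φ n := T.δ_naturality (hS.map_of_exact F) (hS'.map_of_exact F)
    (F.mapShortComplex.map φ) n
  map_comp_zero hS n := T.map_comp_zero (hS.map_of_exact F) n
  comp_δ hS n := T.comp_δ (hS.map_of_exact F) n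
  δ_comp hS n := T.δ_comp (hS.map_of_exact F) n
  exact₁ hS n := T.exact₁ (hS.map_of_exact F) n
  exact₂ hS n := T.exact₂ (hS.map_of_exact F) n
  exact₃ hS n := T.exact₃ (hS.map_of_exact F) n
  mono_zero hS := T.mono_zero (hS.map_of_exact F)

/-- Postcomposition of a cohomological functor with an exact functor. -/
def postcomp (T : CohomologicalFunctor C D) (F : D ⥤ C') [F.Additive]
    [PreservesFiniteLimits F] [PreservesFiniteColimits F] : CohomologicalFunctor C C' where
  T n := T.T n ⋙ F
  δ hS n := F.map (T.δ hS n)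
  δ_naturality hS hS' φ n := by
    simp only [Functor.comp_map, ← F.map_comp, T.δ_naturality hS hS' φ n]
  map_comp_zero hS n := by
    simp only [Functor.comp_map, ← F.map_comp, T.map_comp_zero hS n, F.map_zero]
  comp_δ hS n := by simp only [Functor.comp_map, ← F.map_comp, T.comp_δ hS n, F.map_zero]
  δ_comp hS n := by simp only [Functor.comp_map, ← F.map_comp, T.δ_comp hS n, F.map_zero]
  exact₁ hS n := (T.exact₁ hS n).map F
  exact₂ hS n := (T.exact₂ hS n).map F
  exact₃ hS n := (T.exact₃ hS n).map F
  mono_zero hS := by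
    have := T.mono_zero hS
    exact inferInstanceAs (Mono (F.map ((T.T 0).map _)))

/-- Transport of a cohomological functor along isomorphisms in each degree. -/
def ofIso (T : CohomologicalFunctor C D) (T' : ℕ → C ⥤ D) (e : ∀ n, T.T n ≅ T' n) :
    CohomologicalFunctor C D where
  T := T'
  δ {S} hS n := (e n).inv.app S.X₃ ≫ T.δ hS n ≫ (e (n + 1)).hom.app S.X₁
  δ_naturality hS hS' φ n := by
    have h := T.δ_naturality hS hS' φ n
    simp only [Category.assoc, ← NatTrans.naturality, ← NatTrans.naturality_assoc, reassoc_of% h]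
  map_comp_zero {S} hS n := by
    rw [← cancel_mono ((e n).inv.app S.X₃)]
    simp only [Category.assoc, NatTrans.naturality, NatTrans.naturality_assoc,
      T.map_comp_zero hS n, comp_zero, zero_comp]
  comp_δ hS n := by
    have h := T.comp_δ hS n
    simp only [NatTrans.naturality_assoc, reassoc_of% h, zero_comp, comp_zero]
  δ_comp hS n := by
    have h := T.δ_comp hS n
    simp only [Category.assoc, ← NatTrans.naturality, reassoc_of% h, zero_comp, comp_zero]
  exact₁ {S} hS n := (ShortComplex.exact_iff_of_iso (ShortComplex.isoMk ((e n).app S.X₃)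
    ((e (n + 1)).app S.X₁) ((e (n + 1)).app S.X₂))).1 (T.exact₁ hS n)
  exact₂ {S} hS n := (ShortComplex.exact_iff_of_iso (ShortComplex.isoMk ((e n).app S.X₁)
    ((e n).app S.X₂) ((e n).app S.X₃))).1 (T.exact₂ hS n)
  exact₃ {S} hS n := (ShortComplex.exact_iff_of_iso (ShortComplex.isoMk ((e n).app S.X₂)
    ((e n).app S.X₃) ((e (n + 1)).app S.X₁))).1 (T.exact₃ hS n)
  mono_zero {S} hS := by
    have := T.mono_zero hS
    rw [← NatIso.naturality_1 (e 0) S.f]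
    infer_instance

end Constructions

section Exactness

variable {C : Type u₁} [Category.{v₁} C] [Abelian C] {D : Type u₂} [Category.{v₂} D] [Abelian D]
  (T : CohomologicalFunctor C D)

theorem mono_map_f_of_epi_map_g {S : ShortComplex C} (hS : S.ShortExact)
    (hg : ∀ n, Epi ((T.T n).map S.g)) : ∀ n, Mono ((T.T n).map S.f)
  | 0 => T.mono_zero hS
  | n + 1 => (T.exact₁ hS n).mono_g <| by
    have := hg n
    rw [← cancel_epi ((T.T n).map S.g)]
    exact (T.comp_δ hS n).trans comp_zero.symm

theorem isZero_X₁_of_epi_map_g {S : ShortComplex C} (hS : S.ShortExact) (n : ℕ)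
    [Epi ((T.T n).map S.g)] (h : IsZero ((T.T (n + 1)).obj S.X₂)) :
    IsZero ((T.T (n + 1)).obj S.X₁) := by
  refine (T.exact₁ hS n).isZero_X₂ ?_ (h.eq_of_tgt _ _)
  rw [← cancel_epi ((T.T n).map S.g)]
  exact (T.comp_δ hS n).trans comp_zero.symm

end Exactness

end CohomologicalFunctor

namespace LeftDerivedSequence

theorem exact_iff_forall_exact_evaluation {C : Type u₁} [Category.{v₁} C] {D : Type u₂}
    [Category.{v₂} D] [Abelian D] (S : ShortComplex (C ⥤ D)) :
    S.Exact ↔ ∀ X, (S.map ((evaluation C D).obj X)).Exact := by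
  rw [S.exact_iff_isZero_homology, Functor.isZero_iff]
  refine forall_congr' fun X => ?_
  rw [ShortComplex.exact_iff_isZero_homology]
  exact (S.mapHomologyIso ((evaluation C D).obj X)).symm.isZero_iff

variable {C : Type u₁} [Category.{v₁} C] [Abelian C] {D : Type u₂} [Category.{v₂} D] [Abelian D]
  (S : ShortComplex (C ⥤ D)) [S.X₁.Additive] [S.X₂.Additive] [S.X₃.Additive]

/-- A sequence of functors is short exact on projectives if its values at projective objects are
short exact. This is what makes the left derived functors of its terms fit in a long exact
sequence. -/
def ShortExactOnProjectives : Prop :=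
  ∀ (P : C) [Projective P], (S.map ((evaluation C D).obj P)).ShortExact

/-- The short complex of chain complexes obtained by applying a short complex of functors to a
chain complex. -/
noncomputable abbrev mapComplex (K : ChainComplex C ℕ) : ShortComplex (ChainComplex D ℕ) :=
  ShortComplex.mk ((NatTrans.mapHomologicalComplex S.f _).app K)
    ((NatTrans.mapHomologicalComplex S.g _).app K) (by
      ext n
      exact congrArg (fun α : S.X₁ ⟶ S.X₃ => α.app (K.X n)) S.zero)

variable {S}

theorem ShortExactOnProjectives.mapComplex_shortExact (hS : ShortExactOnProjectives S) {X : C}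
    (P : ProjectiveResolution X) : (mapComplex S P.complex).ShortExact :=
  HomologicalComplex.shortExact_of_degreewise_shortExact _ fun n => hS (P.complex.X n)

variable [EnoughProjectives C]

/-- A left derived functor as homology, computed on the chosen projective resolution. -/
noncomputable abbrev homologyIso (F : C ⥤ D) [F.Additive] (n : ℕ) (X : C) :
    (F.leftDerived n).obj X ≅
      ((F.mapHomologicalComplex _).obj (projectiveResolution X).complex).homology n :=
  (projectiveResolution X).isoLeftDerivedObj F n

theorem homologyIso_hom_naturality {F G : C ⥤ D} [F.Additive] [G.Additive] (α : F ⟶ G)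
    (n : ℕ) (X : C) :
    (NatTrans.leftDerived α n).app X ≫ (homologyIso G n X).hom =
      (homologyIso F n X).hom ≫ HomologicalComplex.homologyMap
        ((NatTrans.mapHomologicalComplex α _).app (projectiveResolution X).complex) n := by
  rw [← Iso.eq_comp_inv, Category.assoc]
  exact (projectiveResolution X).leftDerived_app_eq α n

theorem rel_down (n : ℕ) : (ComplexShape.down ℕ).Rel (n + 1) n := rfl

/-- The connecting morphism of left derived functors attached to a sequence of functors which is
short exact on projectives. -/
noncomputable def leftDerivedδ (hS : ShortExactOnProjectives S) (n : ℕ) :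
    S.X₃.leftDerived (n + 1) ⟶ S.X₁.leftDerived n where
  app X := (homologyIso S.X₃ (n + 1) X).hom ≫
    (hS.mapComplex_shortExact (projectiveResolution X)).δ (n + 1) n (rel_down n) ≫
      (homologyIso S.X₁ n X).inv
  naturality X Y f := by
    let φ := ProjectiveResolution.lift f (projectiveResolution X) (projectiveResolution Y)
    have comm := ProjectiveResolution.lift_commutes_zero f (projectiveResolution X)
      (projectiveResolution Y)
    let ψ : mapComplex S (projectiveResolution X).complex ⟶
        mapComplex S (projectiveResolution Y).complex :=
      { τ₁ := (S.X₁.mapHomologicalComplex _).map φ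
        τ₂ := (S.X₂.mapHomologicalComplex _).map φ
        τ₃ := (S.X₃.mapHomologicalComplex _).map φ
        comm₁₂ := (NatTrans.mapHomologicalComplex S.f _).naturality φ
        comm₂₃ := (NatTrans.mapHomologicalComplex S.g _).naturality φ }
    have h₁ : (homologyIso S.X₁ n X).inv ≫ (S.X₁.leftDerived n).map f =
        HomologicalComplex.homologyMap ψ.τ₁ n ≫ (homologyIso S.X₁ n Y).inv :=
      ProjectiveResolution.isoLeftDerivedObj_inv_naturality f _ _ φ comm S.X₁ n
    have h₃ : (S.X₃.leftDerived (n + 1)).map f ≫ (homologyIso S.X₃ (n + 1) Y).hom =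
        (homologyIso S.X₃ (n + 1) X).hom ≫ HomologicalComplex.homologyMap ψ.τ₃ (n + 1) :=
      ProjectiveResolution.isoLeftDerivedObj_hom_naturality f _ _ φ comm S.X₃ (n + 1)
    have hδ := HomologicalComplex.HomologySequence.δ_naturality ψ (hS.mapComplex_shortExact _)
      (hS.mapComplex_shortExact _) (n + 1) n (rel_down n)
    simp only [Category.assoc]
    rw [reassoc_of% h₃, h₁, reassoc_of% hδ]

theorem leftDerivedδ_app_comp_homologyIso (hS : ShortExactOnProjectives S) (n : ℕ) (X : C) :
    (leftDerivedδ hS n).app X ≫ (homologyIso S.X₁ n X).hom =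
      (homologyIso S.X₃ (n + 1) X).hom ≫
        (hS.mapComplex_shortExact (projectiveResolution X)).δ (n + 1) n (rel_down n) := by
  simp only [leftDerivedδ, Category.assoc, Iso.inv_hom_id, Category.comp_id]

theorem leftDerivedδ_naturality {S' : ShortComplex (C ⥤ D)} [S'.X₁.Additive] [S'.X₂.Additive]
    [S'.X₃.Additive] (hS : ShortExactOnProjectives S) (hS' : ShortExactOnProjectives S')
    (φ : S ⟶ S') (n : ℕ) :
    leftDerivedδ hS n ≫ NatTrans.leftDerived φ.τ₁ n =
      NatTrans.leftDerived φ.τ₃ (n + 1) ≫ leftDerivedδ hS' n := by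
  ext X
  let K := (projectiveResolution X).complex
  let ψ : mapComplex S K ⟶ mapComplex S' K :=
    { τ₁ := (NatTrans.mapHomologicalComplex φ.τ₁ _).app K
      τ₂ := (NatTrans.mapHomologicalComplex φ.τ₂ _).app K
      τ₃ := (NatTrans.mapHomologicalComplex φ.τ₃ _).app K
      comm₁₂ := by
        ext i
        exact congrArg (fun α : S.X₁ ⟶ S'.X₂ => α.app (K.X i)) φ.comm₁₂
      comm₂₃ := by
        ext i
        exact congrArg (fun α : S.X₂ ⟶ S'.X₃ => α.app (K.X i)) φ.comm₂₃ }
  have hδ := HomologicalComplex.HomologySequence.δ_naturality ψ (hS.mapComplex_shortExact _)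
    (hS'.mapComplex_shortExact _) (n + 1) n (rel_down n)
  have h₃ := homologyIso_hom_naturality φ.τ₃ (n + 1) X
  have h₁ := homologyIso_hom_naturality φ.τ₁ n X
  rw [← cancel_mono (homologyIso S'.X₁ n X).hom]
  simp only [NatTrans.comp_app, leftDerivedδ, Category.assoc, Iso.inv_hom_id, Category.comp_id]
  rw [h₁, reassoc_of% h₃, Iso.inv_hom_id_assoc, hδ]

theorem leftDerived_zero {F G : C ⥤ D} [F.Additive] [G.Additive] (n : ℕ) :
    NatTrans.leftDerived (0 : F ⟶ G) n = 0 := by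
  ext X
  have h : (NatTrans.mapHomologicalComplex (0 : F ⟶ G) (ComplexShape.down ℕ)).app
      (projectiveResolution X).complex = 0 := by ext; rfl
  rw [← cancel_mono (homologyIso G n X).hom, homologyIso_hom_naturality, h]
  simp only [HomologicalComplex.homologyMap_zero, comp_zero, NatTrans.app_zero, zero_comp]

variable (S) in
theorem leftDerived_comp_zero (n : ℕ) :
    NatTrans.leftDerived S.f n ≫ NatTrans.leftDerived S.g n = 0 := by
  rw [← NatTrans.leftDerived_comp, S.zero, leftDerived_zero]

theorem leftDerived_comp_δ (hS : ShortExactOnProjectives S) (n : ℕ) :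
    NatTrans.leftDerived S.g (n + 1) ≫ leftDerivedδ hS n = 0 := by
  ext X
  have h := (hS.mapComplex_shortExact (projectiveResolution X)).comp_δ (n + 1) n (rel_down n)
  have hg := homologyIso_hom_naturality S.g (n + 1) X
  rw [← cancel_mono (homologyIso S.X₁ n X).hom]
  simp only [NatTrans.comp_app, Category.assoc, leftDerivedδ_app_comp_homologyIso,
    reassoc_of% hg, h, comp_zero, zero_comp, NatTrans.app_zero]

theorem δ_comp_leftDerived (hS : ShortExactOnProjectives S) (n : ℕ) :
    leftDerivedδ hS n ≫ NatTrans.leftDerived S.f n = 0 := by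
  ext X
  have h := (hS.mapComplex_shortExact (projectiveResolution X)).δ_comp (n + 1) n (rel_down n)
  have hδ := leftDerivedδ_app_comp_homologyIso hS n X
  rw [← cancel_mono (homologyIso S.X₂ n X).hom]
  simp only [NatTrans.comp_app, Category.assoc, homologyIso_hom_naturality S.f n X,
    reassoc_of% hδ, h, comp_zero, zero_comp, NatTrans.app_zero]

theorem leftDerived_exact₂ (hS : ShortExactOnProjectives S) (n : ℕ) :
    (ShortComplex.mk _ _ (leftDerived_comp_zero S n)).Exact :=
  (exact_iff_forall_exact_evaluation _).2 fun X =>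
    (ShortComplex.exact_iff_of_iso (ShortComplex.isoMk
    (homologyIso S.X₁ n X) (homologyIso S.X₂ n X) (homologyIso S.X₃ n X)
    (homologyIso_hom_naturality S.f n X).symm (homologyIso_hom_naturality S.g n X).symm)).2
    ((hS.mapComplex_shortExact (projectiveResolution X)).homology_exact₂ n)

theorem leftDerived_exact₁ (hS : ShortExactOnProjectives S) (n : ℕ) :
    (ShortComplex.mk _ _ (δ_comp_leftDerived hS n)).Exact :=
  (exact_iff_forall_exact_evaluation _).2 fun X =>
    (ShortComplex.exact_iff_of_iso (ShortComplex.isoMk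
    (homologyIso S.X₃ (n + 1) X) (homologyIso S.X₁ n X) (homologyIso S.X₂ n X)
    (leftDerivedδ_app_comp_homologyIso hS n X).symm
    (homologyIso_hom_naturality S.f n X).symm)).2
    ((hS.mapComplex_shortExact (projectiveResolution X)).homology_exact₁ (n + 1) n (rel_down n))

theorem leftDerived_exact₃ (hS : ShortExactOnProjectives S) (n : ℕ) :
    (ShortComplex.mk _ _ (leftDerived_comp_δ hS n)).Exact :=
  (exact_iff_forall_exact_evaluation _).2 fun X =>
    (ShortComplex.exact_iff_of_iso (ShortComplex.isoMk
    (homologyIso S.X₂ (n + 1) X) (homologyIso S.X₃ (n + 1) X) (homologyIso S.X₁ n X)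
    (homologyIso_hom_naturality S.g (n + 1) X).symm
    (leftDerivedδ_app_comp_homologyIso hS n X).symm)).2
    ((hS.mapComplex_shortExact (projectiveResolution X)).homology_exact₃ (n + 1) n (rel_down n))

end LeftDerivedSequence

namespace ExtFunctor

variable (A : Type*) [Ring A] {C : Type u₁} [Category.{v₁} C] [Abelian C] [Linear A C]

/-- The contravariant functors `Hom(-, S.X₃) ⟶ Hom(-, S.X₂) ⟶ Hom(-, S.X₁)`, regarded as
covariant functors into the opposite category of modules, whose left derived functors are the
`Ext` functors. -/
noncomputable abbrev homSeq (S : ShortComplex C) : ShortComplex (C ⥤ (ModuleCat.{v₁} A)ᵒᵖ) :=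
  ShortComplex.mk (NatTrans.rightOp ((linearYoneda A C).map S.g))
    (NatTrans.rightOp ((linearYoneda A C).map S.f)) (by
      change NatTrans.rightOp ((linearYoneda A C).map S.f ≫ (linearYoneda A C).map S.g) = 0
      rw [← Functor.map_comp, S.zero, Functor.map_zero]
      rfl)

theorem homSeq_shortExactOnProjectives {S : ShortComplex C} (hS : S.ShortExact) :
    LeftDerivedSequence.ShortExactOnProjectives (homSeq A S) := by
  intro P _
  have := hS.mono_f
  have := hS.epi_g
  refine ShortComplex.ShortExact.op (S := S.map ((linearCoyoneda A C).obj (op P)))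
    { exact := ?_, mono_f := ?_, epi_g := ?_ }
  · rw [ShortComplex.moduleCat_exact_iff]
    intro (x : P ⟶ S.X₂) (hx : x ≫ S.g = 0)
    exact ⟨hS.exact.lift x hx, hS.exact.lift_f x hx⟩
  · rw [ModuleCat.mono_iff_injective]
    intro (x : P ⟶ S.X₁) (y : P ⟶ S.X₁) (h : x ≫ S.f = y ≫ S.f)
    exact (cancel_mono S.f).1 h
  · rw [ModuleCat.epi_iff_surjective]
    intro (x : P ⟶ S.X₃)
    exact ⟨Projective.factorThru x S.g, Projective.factorThru_comp x S.g⟩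

/-- The contravariant functoriality of `homSeq`. -/
noncomputable abbrev homSeqMap {S S' : ShortComplex C} (φ : S ⟶ S') :
    homSeq A S' ⟶ homSeq A S where
  τ₁ := NatTrans.rightOp ((linearYoneda A C).map φ.τ₃)
  τ₂ := NatTrans.rightOp ((linearYoneda A C).map φ.τ₂)
  τ₃ := NatTrans.rightOp ((linearYoneda A C).map φ.τ₁)
  comm₁₂ := by
    change NatTrans.rightOp ((linearYoneda A C).map S.g ≫ (linearYoneda A C).map φ.τ₃) =
      NatTrans.rightOp ((linearYoneda A C).map φ.τ₂ ≫ (linearYoneda A C).map S'.g)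
    rw [← Functor.map_comp, ← Functor.map_comp, φ.comm₂₃]
  comm₂₃ := by
    change NatTrans.rightOp ((linearYoneda A C).map S.f ≫ (linearYoneda A C).map φ.τ₂) =
      NatTrans.rightOp ((linearYoneda A C).map φ.τ₁ ≫ (linearYoneda A C).map S'.f)
    rw [← Functor.map_comp, ← Functor.map_comp, φ.comm₁₂]

instance (Y : C) : PreservesLimits ((linearYoneda A C).obj Y) :=
  have : PreservesLimits ((linearYoneda A C).obj Y ⋙ forget (ModuleCat.{v₁} A)) :=
    inferInstanceAs (PreservesLimits (yoneda.obj Y))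
  preservesLimits_of_reflects_of_preserves _ (forget _)

instance (Y : C) : PreservesFiniteColimits ((linearYoneda A C).obj Y).rightOp :=
  preservesFiniteColimits_rightOp _

variable [EnoughProjectives C]

theorem fromLeftDerivedZero_naturality {D : Type*} [Category* D] [Abelian D] {F G : C ⥤ D}
    [F.Additive] [G.Additive] (α : F ⟶ G) :
    NatTrans.leftDerived α 0 ≫ G.fromLeftDerivedZero = F.fromLeftDerivedZero ≫ α := by
  ext X
  let P := projectiveResolution X
  let αP := (NatTrans.mapHomologicalComplex α (ComplexShape.down ℕ)).app P.complex
  have hα : HomologicalComplex.opcyclesMap αP 0 ≫ P.fromLeftDerivedZero' G =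
      P.fromLeftDerivedZero' F ≫ α.app X := by
    rw [← cancel_epi (HomologicalComplex.pOpcycles _ _)]
    simp only [HomologicalComplex.p_opcyclesMap_assoc,
      ProjectiveResolution.pOpcycles_comp_fromLeftDerivedZero',
      ProjectiveResolution.pOpcycles_comp_fromLeftDerivedZero'_assoc]
    exact (α.naturality _).symm
  have hι : HomologicalComplex.homologyMap αP 0 ≫ (ChainComplex.isoHomologyι₀ _).hom =
      (ChainComplex.isoHomologyι₀ _).hom ≫ HomologicalComplex.opcyclesMap αP 0 :=
    HomologicalComplex.homologyι_naturality αP 0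
  have hP := LeftDerivedSequence.homologyIso_hom_naturality α 0 X
  have hzero (H : C ⥤ D) [H.Additive] : H.fromLeftDerivedZero.app X =
      (LeftDerivedSequence.homologyIso H 0 X).hom ≫ (ChainComplex.isoHomologyι₀ _).hom ≫
        P.fromLeftDerivedZero' H := P.fromLeftDerivedZero_eq H
  rw [NatTrans.comp_app, NatTrans.comp_app, hzero F, hzero G, reassoc_of% hP, reassoc_of% hι, hα]
  simp only [Category.assoc, P]

theorem isZero_leftDerived_succ {D : Type*} [Category* D] [Abelian D] (F : C ⥤ D) [F.Additive]
    [F.PreservesHomology] (n : ℕ) : IsZero (F.leftDerived (n + 1)) :=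
  (Functor.isZero_iff _).2 fun X => by
    refine IsZero.of_iso ?_ (LeftDerivedSequence.homologyIso F (n + 1) X)
    rw [← HomologicalComplex.exactAt_iff_isZero_homology,
      HomologicalComplex.exactAt_iff' _ (n + 2) (n + 1) n (by simp) (by simp)]
    exact ((projectiveResolution X).exact_succ n).map F

instance (E : C) [Injective E] : ((linearYoneda A C).obj E).rightOp.PreservesMonomorphisms where
  preserves {X Y} f _ := by
    have : Epi (((linearYoneda A C).obj E).map f.op) := by
      rw [ModuleCat.epi_iff_surjective]
      intro (x : X ⟶ E)
      exact ⟨Injective.factorThru x f, Injective.comp_factorThru x f⟩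
    exact inferInstanceAs (Mono (((linearYoneda A C).obj E).map f.op).op)

instance (E : C) [Injective E] : ((linearYoneda A C).obj E).rightOp.PreservesHomology :=
  Functor.preservesHomology_of_preservesMonos_and_cokernels _

/-- In degree `0`, `Ext` is the bifunctor of morphisms. -/
noncomputable def extZeroIso : linearYoneda A C ≅ (Ext A C 0).flip :=
  NatIso.ofComponents
    (fun Y =>
      { hom := NatTrans.leftOp ((linearYoneda A C).obj Y).rightOp.leftDerivedZeroIsoSelf.hom
        inv := NatTrans.leftOp ((linearYoneda A C).obj Y).rightOp.leftDerivedZeroIsoSelf.inv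
        hom_inv_id := congrArg NatTrans.leftOp (Iso.inv_hom_id _)
        inv_hom_id := congrArg NatTrans.leftOp (Iso.hom_inv_id _) })
    fun f => congrArg NatTrans.leftOp
      (fromLeftDerivedZero_naturality (NatTrans.rightOp ((linearYoneda A C).map f))).symm

instance {Y Z : C} (f : Y ⟶ Z) [Mono f] : Mono ((linearYoneda A C).map f) := by
  have (X : Cᵒᵖ) : Mono (((linearYoneda A C).map f).app X) := by
    rw [ModuleCat.mono_iff_injective]
    intro (x : X.unop ⟶ Y) (y : X.unop ⟶ Y) (h : x ≫ f = y ≫ f)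
    exact (cancel_mono f).1 h
  exact NatTrans.mono_of_mono_app _

/-- The functors `Y ↦ Extⁿ(-, Y)` form a cohomological functor. -/
noncomputable def ext : CohomologicalFunctor C (Cᵒᵖ ⥤ ModuleCat.{v₁} A) where
  T n := (Ext A C n).flip
  δ hS n := NatTrans.leftOp
    (LeftDerivedSequence.leftDerivedδ (homSeq_shortExactOnProjectives A hS) n)
  δ_naturality hS hS' φ n :=
    congrArg NatTrans.leftOp (LeftDerivedSequence.leftDerivedδ_naturality
      (homSeq_shortExactOnProjectives A hS') (homSeq_shortExactOnProjectives A hS)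
      (homSeqMap A φ) n).symm
  map_comp_zero {S} _ n :=
    congrArg NatTrans.leftOp (LeftDerivedSequence.leftDerived_comp_zero (homSeq A S) n)
  comp_δ hS n := congrArg NatTrans.leftOp
    (LeftDerivedSequence.δ_comp_leftDerived (homSeq_shortExactOnProjectives A hS) n)
  δ_comp hS n := congrArg NatTrans.leftOp
    (LeftDerivedSequence.leftDerived_comp_δ (homSeq_shortExactOnProjectives A hS) n)
  exact₁ hS n := (LeftDerivedSequence.exact_iff_forall_exact_evaluation _).2 fun X =>
    ((LeftDerivedSequence.exact_iff_forall_exact_evaluation _).1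
      (LeftDerivedSequence.leftDerived_exact₃ (homSeq_shortExactOnProjectives A hS) n) X.unop).unop
  exact₂ hS n := (LeftDerivedSequence.exact_iff_forall_exact_evaluation _).2 fun X =>
    ((LeftDerivedSequence.exact_iff_forall_exact_evaluation _).1
      (LeftDerivedSequence.leftDerived_exact₂ (homSeq_shortExactOnProjectives A hS) n) X.unop).unop
  exact₃ hS n := (LeftDerivedSequence.exact_iff_forall_exact_evaluation _).2 fun X =>
    ((LeftDerivedSequence.exact_iff_forall_exact_evaluation _).1
      (LeftDerivedSequence.leftDerived_exact₁ (homSeq_shortExactOnProjectives A hS) n) X.unop).unop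
  mono_zero {S} hS := by
    have := hS.mono_f
    rw [← NatIso.naturality_1 (extZeroIso A) S.f]
    infer_instance

theorem ext_effaceable : (ext A (C := C)).Effaceable := fun n E _ =>
  (Functor.isZero_iff _).2 fun X => ((Functor.isZero_iff _).1
    (isZero_leftDerived_succ ((linearYoneda A C).obj E).rightOp n) X.unop).unop

theorem leftDerived_app_eq_map {D : Type*} [Category* D] [Abelian D] {F : C ⥤ D} [F.Additive]
    {α : F ⟶ F} {e : 𝟭 C ⟶ 𝟭 C} (h : ∀ X, α.app X = F.map (e.app X)) (n : ℕ) (X : C) :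
    (NatTrans.leftDerived α n).app X = (F.leftDerived n).map (e.app X) := by
  let P := projectiveResolution X
  let eP : P.complex ⟶ P.complex :=
    { f := fun i => e.app (P.complex.X i)
      comm' := fun _ _ _ => (e.naturality _).symm }
  have hαP : (NatTrans.mapHomologicalComplex α _).app P.complex =
      (F.mapHomologicalComplex _).map eP := by
    ext i
    exact h _
  have heP : eP.f 0 ≫ P.π.f 0 = P.π.f 0 ≫ e.app X := (e.naturality (P.π.f 0)).symm
  have hmap : (F.leftDerived n).map (e.app X) ≫ (LeftDerivedSequence.homologyIso F n X).hom =
      (LeftDerivedSequence.homologyIso F n X).hom ≫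
        HomologicalComplex.homologyMap ((F.mapHomologicalComplex _).map eP) n :=
    ProjectiveResolution.isoLeftDerivedObj_hom_naturality _ P P eP heP F n
  rw [← cancel_mono (LeftDerivedSequence.homologyIso F n X).hom, hmap,
    LeftDerivedSequence.homologyIso_hom_naturality, hαP]

instance {D : Type*} [Category* D] [Abelian D] (F : C ⥤ D) [F.Additive] (n : ℕ) :
    (F.leftDerived n).PreservesZeroMorphisms where
  map_zero X Y := by
    rw [F.leftDerived_map_eq n 0 (P := projectiveResolution X) (Q := projectiveResolution Y) 0
      (by simp), Functor.map_zero]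
    exact (congrArg _ zero_comp).trans comp_zero

theorem ext_map_smul (X : C) (Y : C) (r : A) (n : ℕ) :
    ((Ext A C n).obj (op X)).map (r • 𝟙 Y) = ((Ext A C n).map (r • 𝟙 X).op).app Y :=
  congrArg Quiver.Hom.unop (leftDerived_app_eq_map (F := ((linearYoneda A C).obj Y).rightOp)
    (α := NatTrans.rightOp ((linearYoneda A C).map (r • 𝟙 Y)))
    (e := r • 𝟙 (𝟭 C)) (fun Z => Quiver.Hom.unop_inj (ModuleCat.hom_ext (LinearMap.ext
      fun (f : Z ⟶ Y) => by
        change f ≫ (r • 𝟙 Y) = (r • 𝟙 Z) ≫ f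
        rw [Linear.comp_smul, Linear.smul_comp, Category.id_comp, Category.comp_id]))) n X)

theorem ext_map_smul_eq_zero {X : C} {r : A} (hr : r • 𝟙 X = 0) (Y : C) (n : ℕ) :
    ((Ext A C n).obj (op X)).map (r • 𝟙 Y) = 0 := by
  rw [ext_map_smul, hr]
  exact congrArg Quiver.Hom.unop
    (Functor.map_zero (((linearYoneda A C).obj Y).rightOp.leftDerived n) X X)

end ExtFunctor

namespace LocalCohomology

open ExtFunctor

variable {R : Type u} [CommRing R]

instance : PreservesColimitsOfShape (ℕᵒᵖ)ᵒᵖ (forget (ModuleCat.{u} R)) :=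
  have := preservesFilteredColimitsOfSize_shrink.{0, u, 0, u} (forget (ModuleCat.{u} R))
  PreservesFilteredColimitsOfSize.preserves_filtered_colimits _

variable (J : Ideal R)

/-- The inverse system of the modules `R ⧸ J ^ t`. -/
noncomputable abbrev quotPow : ℕᵒᵖ ⥤ ModuleCat.{u} R :=
  localCohomology.ringModIdeals (localCohomology.idealPowersDiagram J)

/-- Local cohomology as a cohomological functor: the colimit of the functors `Ext (R ⧸ J ^ t) -`. -/
noncomputable def cohomologicalFunctor :
    CohomologicalFunctor (ModuleCat.{u} R) (ModuleCat.{u} R) :=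
  ((ext R).postcomp ((Functor.whiskeringLeft _ _ _).obj (quotPow J).op ⋙ colim)).ofIso
    (localCohomology J) fun n =>
      (colimitIsoFlipCompColim
        (localCohomology.diagram (localCohomology.idealPowersDiagram J) n)).symm

theorem effaceable : (cohomologicalFunctor J).Effaceable := fun n E _ =>
  (Functor.map_isZero ((Functor.whiskeringLeft _ _ _).obj (quotPow J).op ⋙ colim)
    (ext_effaceable R n E inferInstance)).of_iso
    ((colimitIsoFlipCompColim (localCohomology.diagram _ _)).app E)

/-- The natural map from `Ext n (R ⧸ J ^ t) -` to local cohomology. -/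
noncomputable def ofExt (n t : ℕ) :
    (Ext R (ModuleCat.{u} R) n).obj (op ((quotPow J).obj (op t))) ⟶ localCohomology J n :=
  colimit.ι (localCohomology.diagram (localCohomology.idealPowersDiagram J) n) (op (op t))

theorem exists_ofExt_app_eq (n : ℕ) {M : ModuleCat.{u} R} (ξ : (localCohomology J n).obj M) :
    ∃ t y, (ofExt J n t).app M y = ξ := by
  obtain ⟨t, y, hy⟩ := Concrete.isColimit_exists_rep _
    (isColimitOfPreserves ((evaluation _ _).obj M) (colimit.isColimit
      (localCohomology.diagram (localCohomology.idealPowersDiagram J) n))) ξ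
  exact ⟨t.unop.unop, y, hy⟩

theorem exists_pow_map_smul_eq_zero (n : ℕ) {M : ModuleCat.{u} R}
    (ξ : (localCohomology J n).obj M) :
    ∃ t, ∀ r ∈ J ^ t, (localCohomology J n).map (r • 𝟙 M) ξ = 0 := by
  obtain ⟨t, y, rfl⟩ := exists_ofExt_app_eq J n ξ
  refine ⟨t, fun r hr => ?_⟩
  have hr₀ : r • 𝟙 ((quotPow J).obj (op t)) = 0 := by
    ext (x : R ⧸ J ^ t)
    obtain ⟨x, rfl⟩ := Ideal.Quotient.mk_surjective x
    exact Ideal.Quotient.eq_zero_iff_mem.2 (Ideal.mul_mem_right x _ hr)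
  have hy := ConcreteCategory.congr_hom (ext_map_smul_eq_zero R hr₀ M n) y
  exact (ConcreteCategory.congr_hom ((ofExt J n t).naturality (r • 𝟙 M)) y).symm.trans
    ((congrArg ((ofExt J n t).app M) hy).trans (map_zero ((ofExt J n t).app M).hom))

/-- Evaluation at `1` of a morphism from `R ⧸ J ^ t`. -/
noncomputable def evalOne (t : ℕ) (M : ModuleCat.{u} R) :
    ((linearYoneda R (ModuleCat.{u} R)).obj M).obj (op ((quotPow J).obj (op t))) ⟶ M :=
  ModuleCat.ofHom (X := (quotPow J).obj (op t) ⟶ M)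
    { toFun := fun f => f (Ideal.Quotient.mk (J ^ t) 1 : R ⧸ J ^ t)
      map_add' := fun _ _ => rfl
      map_smul' := fun _ _ => rfl }

theorem evalOne_injective (t : ℕ) (M : ModuleCat.{u} R) :
    Function.Injective (evalOne J t M) := by
  intro (f : (quotPow J).obj (op t) ⟶ M) (g : (quotPow J).obj (op t) ⟶ M) h
  refine ModuleCat.hom_ext (Submodule.linearMap_qext (J ^ t) (LinearMap.ext_ring h))

/-- Evaluation at `1` as a natural transformation from `Ext 0 (R ⧸ J ^ t) -` to the identity. -/
noncomputable def extZeroToSelf (t : ℕ) :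
    (Ext R (ModuleCat.{u} R) 0).obj (op ((quotPow J).obj (op t))) ⟶ 𝟭 (ModuleCat.{u} R) where
  app M := ((extZeroIso R (C := ModuleCat.{u} R)).inv.app M).app _ ≫ evalOne J t M
  naturality _ N f :=
    (Category.assoc _ _ _).symm.trans <| congrArg (· ≫ evalOne J t N) <|
      NatTrans.congr_app ((extZeroIso R (C := ModuleCat.{u} R)).inv.naturality f)
        (op ((quotPow J).obj (op t)))

theorem ext_map_extZeroToSelf {s t : ℕ} (h : op t ⟶ op s) :
    (Ext R (ModuleCat.{u} R) 0).map ((quotPow J).map h).op ≫ extZeroToSelf J t =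
      extZeroToSelf J s := by
  ext M : 2
  exact (Category.assoc _ _ _).symm.trans <| congrArg (· ≫ evalOne J t M) <|
      ((extZeroIso R (C := ModuleCat.{u} R)).inv.app M).naturality ((quotPow J).map h).op

/-- The natural map from the `0`-th local cohomology of `M` to `M`. -/
noncomputable def toSelf : localCohomology J 0 ⟶ 𝟭 (ModuleCat.{u} R) :=
  colimit.desc (localCohomology.diagram (localCohomology.idealPowersDiagram J) 0)
    { pt := 𝟭 _
      ι :=
        { app := fun t => extZeroToSelf J t.unop.unop
          naturality := fun _ _ h => ext_map_extZeroToSelf J h.unop } }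

theorem ofExt_toSelf (t : ℕ) (M : ModuleCat.{u} R) :
    (ofExt J 0 t).app M ≫ (toSelf J).app M =
      ((extZeroIso R (C := ModuleCat.{u} R)).inv.app M).app (op ((quotPow J).obj (op t))) ≫
        evalOne J t M :=
  NatTrans.congr_app (colimit.ι_desc _ (op (op t))) M

theorem toSelf_injective (M : ModuleCat.{u} R) : Function.Injective ((toSelf J).app M) := by
  rw [injective_iff_map_eq_zero]
  intro ξ hξ
  obtain ⟨t, y, rfl⟩ := exists_ofExt_app_eq J 0 ξ
  let e := ((extZeroIso R (C := ModuleCat.{u} R)).app M).app (op ((quotPow J).obj (op t)))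
  have hey : e.inv y = 0 := evalOne_injective J t M
    ((ConcreteCategory.congr_hom (ofExt_toSelf J t M) y).symm.trans
      (hξ.trans (map_zero (evalOne J t M).hom).symm))
  have hy : y = 0 := (ConcreteCategory.congr_hom e.inv_hom_id y).symm.trans
    ((congrArg e.hom hey).trans (map_zero e.hom.hom))
  exact (congrArg ((ofExt J 0 t).app M) hy).trans (map_zero ((ofExt J 0 t).app M).hom)

theorem mem_range_toSelf {M : ModuleCat.{u} R} {m : M} :
    (∃ ξ, (toSelf J).app M ξ = m) ↔ ∃ t, ∀ r ∈ J ^ t, r • m = 0 := by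
  constructor
  · rintro ⟨ξ, rfl⟩
    obtain ⟨t, ht⟩ := exists_pow_map_smul_eq_zero J 0 ξ
    refine ⟨t, fun r hr => ?_⟩
    have h := ConcreteCategory.congr_hom ((toSelf J).naturality (r • 𝟙 M)) ξ
    exact h.symm.trans ((congrArg ((toSelf J).app M) (ht r hr)).trans
      (map_zero ((toSelf J).app M).hom))
  · rintro ⟨t, ht⟩
    let f : (quotPow J).obj (op t) ⟶ M :=
      ModuleCat.ofHom (Submodule.liftQ (J ^ t) (LinearMap.toSpanSingleton R M m) ht)
    let e := ((extZeroIso R (C := ModuleCat.{u} R)).app M).app (op ((quotPow J).obj (op t)))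
    refine ⟨(ofExt J 0 t).app M (e.hom f), ?_⟩
    have h := ConcreteCategory.congr_hom (ofExt_toSelf J t M) (e.hom f)
    exact h.trans ((congrArg (evalOne J t M) (ConcreteCategory.congr_hom e.hom_inv_id f)).trans
      (one_smul R m))

end LocalCohomology

section PowTorsion

variable {B : Type*} [CommRing B] (I : Ideal B) (E : Type*) [AddCommGroup E] [Module B E]

/-- The submodule of elements annihilated by a power of the ideal `I`. -/
def powTorsion : Submodule B E where
  carrier := {e | ∃ t, ∀ r ∈ I ^ t, r • e = 0}
  zero_mem' := ⟨0, fun _ _ => smul_zero _⟩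
  add_mem' := by
    rintro a b ⟨s, hs⟩ ⟨t, ht⟩
    refine ⟨s + t, fun r hr => ?_⟩
    rw [smul_add, hs r (Ideal.pow_le_pow_right (Nat.le_add_right s t) hr),
      ht r (Ideal.pow_le_pow_right (Nat.le_add_left t s) hr), add_zero]
  smul_mem' := by
    rintro c a ⟨s, hs⟩
    exact ⟨s, fun r hr => by rw [smul_comm, hs r hr, smul_zero]⟩

variable {I E}

theorem mem_powTorsion {e : E} : e ∈ powTorsion I E ↔ ∃ t, ∀ r ∈ I ^ t, r • e = 0 := Iff.rfl

theorem mem_powTorsion_span_singleton {b : B} {e : E} :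
    e ∈ powTorsion (Ideal.span {b}) E ↔ ∃ t, b ^ t • e = 0 := by
  simp only [mem_powTorsion, Ideal.span_singleton_pow, Ideal.mem_span_singleton',
    forall_exists_index, forall_apply_eq_imp_iff, mul_smul]
  exact exists_congr fun t => ⟨fun h => by simpa using h 1, fun h c => by rw [h, smul_zero]⟩

theorem mem_powTorsion_iff_le_radical (hI : I.FG) {e : E} :
    e ∈ powTorsion I E ↔ I ≤ Ideal.radical (LinearMap.ker (LinearMap.toSpanSingleton B E e)) := by
  refine ⟨?_, fun h => Ideal.exists_pow_le_of_le_radical_of_fg h hI⟩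
  rintro ⟨t, ht⟩ r hr
  exact ⟨t, ht _ (Ideal.pow_mem_pow hr t)⟩

theorem exists_pow_smul_eq_zero_of_fg {N : Submodule B E} (hN : N.FG) (h : N ≤ powTorsion I E) :
    ∃ t, ∀ r ∈ I ^ t, ∀ e ∈ N, r • e = 0 := by
  obtain ⟨s, rfl⟩ := hN
  choose! t ht using fun e (he : e ∈ s) => mem_powTorsion.1 (h (Submodule.subset_span he))
  refine ⟨s.sup t, fun r hr e he => ?_⟩
  induction he using Submodule.span_induction with
  | mem e he => exact ht e he r (Ideal.pow_le_pow_right (Finset.le_sup he) hr)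
  | zero => exact smul_zero _
  | add a b _ _ ha hb => rw [smul_add, ha, hb, add_zero]
  | smul c a _ ha => rw [smul_comm, ha, smul_zero]

-- By Artin–Rees, `I ^ m ∩ K ≤ I ^ s K` for large `m`, where `I ^ s` kills the image of `g`.
theorem exists_pow_inf_le_ker [IsNoetherianRing B] {K : Ideal B} (g : K →ₗ[B] E)
    (hg : LinearMap.range g ≤ powTorsion I E) :
    ∃ m, ∀ x : K, (x : B) ∈ I ^ m → g x = 0 := by
  obtain ⟨s, hs⟩ := exists_pow_smul_eq_zero_of_fg
    (LinearMap.range_eq_map g ▸ (IsNoetherian.noetherian _).map g) hg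
  obtain ⟨k, hk⟩ := Ideal.exists_pow_inf_eq_pow_smul (M := B) I K
  refine ⟨s + k, fun x hx => ?_⟩
  have hxK : (x : B) ∈ I ^ s • K := by
    have h : (x : B) ∈ I ^ (s + k) • (⊤ : Submodule B B) ⊓ K :=
      ⟨by rwa [smul_eq_mul, Ideal.mul_top], x.2⟩
    rw [hk (s + k) (Nat.le_add_left k s), Nat.add_sub_cancel] at h
    exact Submodule.smul_mono le_rfl inf_le_right h
  have hle : I ^ s • K ≤ (LinearMap.ker g).map (Submodule.subtype K) :=
    Submodule.smul_le.2 fun r hr y hy => ⟨r • ⟨y, hy⟩, by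
      rw [SetLike.mem_coe, LinearMap.mem_ker, map_smul, hs r hr _ ⟨_, rfl⟩], rfl⟩
  obtain ⟨y, hy, hyx⟩ := hle hxK
  rwa [← Subtype.ext hyx]

theorem exists_forall_smul_eq_of_baer (hE : Module.Baer B E) (f : B →ₗ.[B] E) :
    ∃ e : E, ∀ x : f.domain, (x : B) • e = f x := by
  obtain ⟨g, hg⟩ := hE f.domain f.toFun
  exact ⟨g 1, fun x => by rw [← map_smul, smul_eq_mul, mul_one]; exact hg x x.2⟩

theorem baer_powTorsion [IsNoetherianRing B] (hE : Module.Baer B E) (I : Ideal B) :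
    Module.Baer B (powTorsion I E) := by
  intro K g
  obtain ⟨m, hm⟩ := exists_pow_inf_le_ker (I := I) ((powTorsion I E).subtype ∘ₗ g)
    (by rintro _ ⟨x, rfl⟩; exact (g x).2)
  let f : B →ₗ.[B] E := ⟨K, (powTorsion I E).subtype ∘ₗ g⟩
  let z : B →ₗ.[B] E := ⟨I ^ m, 0⟩
  have h : ∀ (x : f.domain) (y : z.domain), (x : B) = y → f x = z y := fun x y hxy =>
    hm x (hxy ▸ y.2)
  obtain ⟨e, he⟩ := exists_forall_smul_eq_of_baer hE (f.sup z h)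
  have hz : ∀ r ∈ I ^ m, r • e = 0 := fun r hr =>
    (he ⟨r, (f.right_le_sup z h).1 hr⟩).trans ((f.right_le_sup z h).2 (x := ⟨r, hr⟩) rfl).symm
  refine ⟨LinearMap.toSpanSingleton B _ ⟨e, m, hz⟩, fun x hx => Subtype.ext ?_⟩
  exact (he ⟨x, (f.left_le_sup z h).1 hx⟩).trans ((f.left_le_sup z h).2 (x := ⟨x, hx⟩) rfl).symm

theorem exists_smul_eq_of_baer (hE : Module.Baer B E) {b : B} {e : E}
    (h : ∀ r, r * b = 0 → r • e = 0) : ∃ e' : E, b • e' = e := by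
  obtain ⟨e', he'⟩ := exists_forall_smul_eq_of_baer hE (LinearPMap.mkSpanSingleton' b e h)
  exact ⟨e', (he' ⟨b, Submodule.mem_span_singleton_self b⟩).trans
    (LinearPMap.mkSpanSingleton'_apply_self _ _ _ _)⟩

theorem exists_forall_mul_pow_eq_zero [IsNoetherianRing B] (b : B) :
    ∃ n, ∀ r, r * b ^ (n + 1) = 0 → r * b ^ n = 0 := by
  obtain ⟨n, hn⟩ := (LinearMap.eventually_iSup_ker_pow_eq (LinearMap.mulRight B b)).exists
  refine ⟨n, fun r hr => ?_⟩
  have h : r ∈ LinearMap.ker (LinearMap.mulRight B b ^ n) :=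
    hn.le (Submodule.mem_iSup_of_mem (n + 1) (by simpa [LinearMap.pow_mulRight] using hr))
  simpa [LinearMap.pow_mulRight] using h

theorem bijective_smul_quotient_powTorsion [IsNoetherianRing B] (hE : Module.Baer B E) (b : B) :
    Function.Bijective fun e : E ⧸ powTorsion (Ideal.span {b}) E => b • e := by
  constructor
  · refine (injective_iff_map_eq_zero (DistribSMul.toAddMonoidHom _ b)).2 fun e he => ?_
    obtain ⟨e, rfl⟩ := Submodule.Quotient.mk_surjective _ e
    rw [DistribSMul.toAddMonoidHom_apply, ← Submodule.Quotient.mk_smul,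
      Submodule.Quotient.mk_eq_zero, mem_powTorsion_span_singleton] at he
    obtain ⟨t, ht⟩ := he
    rw [Submodule.Quotient.mk_eq_zero, mem_powTorsion_span_singleton]
    exact ⟨t + 1, by rw [pow_succ, mul_smul, ht]⟩
  · intro e
    obtain ⟨e, rfl⟩ := Submodule.Quotient.mk_surjective _ e
    obtain ⟨n, hn⟩ := exists_forall_mul_pow_eq_zero b
    obtain ⟨e', he'⟩ := exists_smul_eq_of_baer hE (b := b ^ (n + 1)) (e := b ^ n • e) fun r hr => by
      rw [← mul_smul, hn r hr, zero_smul]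
    refine ⟨Submodule.Quotient.mk e', ?_⟩
    change Submodule.Quotient.mk (b • e') = _
    rw [Submodule.Quotient.eq, mem_powTorsion_span_singleton]
    exact ⟨n, by rw [smul_sub, ← mul_smul, ← pow_succ, he', sub_self]⟩

end PowTorsion

namespace LocalCohomology

section Acyclic

variable {A : Type u} [CommRing A] (I : Ideal A)

theorem isZero_of_bijective_smul {M : ModuleCat.{u} A} {a : A} (ha : a ∈ I)
    (h : Function.Bijective fun m : M => a • m) (n : ℕ) : IsZero ((localCohomology I n).obj M) := by
  rw [ModuleCat.isZero_iff_subsingleton, subsingleton_iff_forall_eq 0]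
  intro ξ
  obtain ⟨t, ht⟩ := exists_pow_map_smul_eq_zero I n ξ
  have : IsIso (a ^ t • 𝟙 M) := by
    rw [ConcreteCategory.isIso_iff_bijective]
    have := h.iterate t
    rwa [smul_iterate] at this
  exact (ConcreteCategory.bijective_of_isIso ((localCohomology I n).map (a ^ t • 𝟙 M))).1
    ((ht _ (Ideal.pow_mem_pow ha t)).trans (map_zero _).symm)

/-- The short exact sequence of a submodule and its quotient. -/
noncomputable abbrev submoduleSeq {E : Type u} [AddCommGroup E] [Module A E] (N : Submodule A E) :
    ShortComplex (ModuleCat.{u} A) :=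
  ShortComplex.mk (X₁ := ModuleCat.of A N) (X₂ := ModuleCat.of A E) (X₃ := ModuleCat.of A (E ⧸ N))
    (ModuleCat.ofHom N.subtype) (ModuleCat.ofHom N.mkQ)
    (ModuleCat.hom_ext (LinearMap.ext fun x => (Submodule.Quotient.mk_eq_zero _).2 x.2))

theorem submoduleSeq_shortExact {E : Type u} [AddCommGroup E] [Module A E] (N : Submodule A E) :
    (submoduleSeq N).ShortExact where
  exact := (ShortComplex.moduleCat_exact_iff _).2 fun x hx =>
    ⟨⟨x, (Submodule.Quotient.mk_eq_zero _).1 hx⟩, rfl⟩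
  mono_f := (ModuleCat.mono_iff_injective _).2 N.subtype_injective
  epi_g := (ModuleCat.epi_iff_surjective _).2 N.mkQ_surjective

theorem baer_of_injective (E : ModuleCat.{u} A) [Injective E] : Module.Baer A E :=
  have : Injective (ModuleCat.of A E) := ‹Injective E›
  .of_injective (Module.injective_module_of_injective_object A E)

theorem exists_injective_torsion [IsNoetherianRing A] {M : ModuleCat.{u} A}
    (hM : powTorsion I M = ⊤) :
    ∃ (G : ModuleCat.{u} A) (j : M ⟶ G), Injective G ∧ powTorsion I G = ⊤ ∧ Mono j := by
  let E := Injective.under M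
  let i : M ⟶ E := Injective.ι M
  have hi : ∀ m : M, i m ∈ powTorsion I E := fun m => by
    obtain ⟨t, ht⟩ := (hM ▸ Submodule.mem_top : m ∈ powTorsion I M)
    exact ⟨t, fun r hr => by rw [← map_smul i.hom, ht r hr, map_zero]⟩
  have := (baer_powTorsion (baer_of_injective E) I).injective
  refine ⟨ModuleCat.of A (powTorsion I E), ModuleCat.ofHom (i.hom.codRestrict _ hi),
    Module.injective_object_of_injective_module A _, ?_, ?_⟩
  · exact eq_top_iff.2 fun ⟨e, t, ht⟩ _ => ⟨t, fun r hr => Subtype.ext (ht r hr)⟩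
  · exact (ModuleCat.mono_iff_injective _).2 fun a b h =>
      (ModuleCat.mono_iff_injective i).1 inferInstance (congrArg Subtype.val h)

theorem epi_map_zero_of_torsion {M N : ModuleCat.{u} A} (g : M ⟶ N) [Epi g]
    (hM : powTorsion I M = ⊤) : Epi ((localCohomology I 0).map g) := by
  rw [ModuleCat.epi_iff_surjective]
  intro ξ
  obtain ⟨m, hm⟩ := (ModuleCat.epi_iff_surjective g).1 inferInstance ((toSelf I).app N ξ)
  obtain ⟨η, hη⟩ := (mem_range_toSelf I).2 (hM ▸ Submodule.mem_top : m ∈ powTorsion I M)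
  exact ⟨η, toSelf_injective I N <| (ConcreteCategory.congr_hom ((toSelf I).naturality g) η).trans
    ((congrArg g hη).trans hm)⟩

theorem powTorsion_eq_top_of_epi {M N : ModuleCat.{u} A} (g : M ⟶ N) [Epi g]
    (hM : powTorsion I M = ⊤) : powTorsion I N = ⊤ := by
  refine eq_top_iff.2 fun n _ => ?_
  obtain ⟨m, rfl⟩ := (ModuleCat.epi_iff_surjective g).1 inferInstance n
  obtain ⟨t, ht⟩ := (hM ▸ Submodule.mem_top : m ∈ powTorsion I M)
  exact ⟨t, fun r hr => by rw [← map_smul g.hom, ht r hr, map_zero]⟩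

theorem isZero_succ_of_forall_epi [IsNoetherianRing A] {n : ℕ}
    (h : ∀ {M N : ModuleCat.{u} A} (g : M ⟶ N) [Epi g], powTorsion I M = ⊤ →
      Epi ((localCohomology I n).map g)) {M : ModuleCat.{u} A} (hM : powTorsion I M = ⊤) :
    IsZero ((localCohomology I (n + 1)).obj M) := by
  obtain ⟨G, j, hG, hG', hj⟩ := exists_injective_torsion I hM
  have hS : (ShortComplex.mk j (cokernel.π j) (cokernel.condition j)).ShortExact :=
    { exact := ShortComplex.exact_of_g_is_cokernel _ (cokernelIsCokernel _) }
  have : Epi (((cohomologicalFunctor I).T n).map (cokernel.π j)) := h _ hG'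
  exact (cohomologicalFunctor I).isZero_X₁_of_epi_map_g hS n (effaceable I n G hG)

theorem isZero_of_torsion [IsNoetherianRing A] (n : ℕ) {M : ModuleCat.{u} A}
    (hM : powTorsion I M = ⊤) : IsZero ((localCohomology I (n + 1)).obj M) := by
  induction n generalizing M with
  | zero => exact isZero_succ_of_forall_epi I (epi_map_zero_of_torsion I) hM
  | succ n ih =>
    exact isZero_succ_of_forall_epi I
      (fun g _ hM' => ⟨fun _ _ _ => (ih (powTorsion_eq_top_of_epi I g hM')).eq_of_src _ _⟩) hM

end Acyclic

end LocalCohomology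

theorem exists_natTrans_comp_eq {C : Type u₁} [Category.{v₁} C] {A : Type u} [CommRing A]
    {F G H : C ⥤ ModuleCat.{v₂} A} (a : F ⟶ H) (b : G ⟶ H)
    (hb : ∀ M, Function.Injective (b.app M))
    (hab : ∀ M, LinearMap.range (a.app M).hom ≤ LinearMap.range (b.app M).hom) :
    ∃ c : F ⟶ G, c ≫ b = a := by
  have (M : C) : Mono (b.app M) := (ModuleCat.mono_iff_injective _).2 (hb M)
  have h (M : C) : ∃ c : F.obj M ⟶ G.obj M, c ≫ b.app M = a.app M := by
    let e := LinearEquiv.ofInjective (b.app M).hom (hb M)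
    refine ⟨ModuleCat.ofHom (e.symm.toLinearMap ∘ₗ
      (a.app M).hom.codRestrict _ fun y => hab M ⟨y, rfl⟩), ?_⟩
    ext y
    exact congrArg Subtype.val (e.apply_symm_apply _)
  choose c hc using h
  refine ⟨{ app := c, naturality := fun M N f => ?_ }, NatTrans.ext (funext hc)⟩
  rw [← cancel_mono (b.app N), Category.assoc, Category.assoc, hc, b.naturality,
    reassoc_of% hc, a.naturality]

theorem nonempty_natIso_of_range_eq {C : Type u₁} [Category.{v₁} C] {A : Type u} [CommRing A]
    {F G H : C ⥤ ModuleCat.{v₂} A} (a : F ⟶ H) (b : G ⟶ H)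
    (ha : ∀ M, Function.Injective (a.app M)) (hb : ∀ M, Function.Injective (b.app M))
    (hab : ∀ M, LinearMap.range (a.app M).hom = LinearMap.range (b.app M).hom) :
    Nonempty (F ≅ G) := by
  have (M : C) : Mono (a.app M) := (ModuleCat.mono_iff_injective _).2 (ha M)
  have (M : C) : Mono (b.app M) := (ModuleCat.mono_iff_injective _).2 (hb M)
  have : Mono a := NatTrans.mono_of_mono_app a
  have : Mono b := NatTrans.mono_of_mono_app b
  obtain ⟨c, hc⟩ := exists_natTrans_comp_eq a b hb fun M => (hab M).le
  obtain ⟨d, hd⟩ := exists_natTrans_comp_eq b a ha fun M => (hab M).ge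
  exact ⟨⟨c, d, by rw [← cancel_mono a, Category.assoc, hd, hc, Category.id_comp],
    by rw [← cancel_mono b, Category.assoc, hc, hd, Category.id_comp]⟩⟩

theorem mono_map_of_iso {C : Type u₁} [Category.{v₁} C] {D : Type u₂} [Category.{v₂} D]
    {F G : C ⥤ D} (e : F ≅ G) {M N : C} (φ : M ⟶ N) [Mono (F.map φ)] : Mono (G.map φ) := by
  rw [← NatIso.naturality_1 e φ]
  infer_instance

namespace LocalCohomology

section BaseChange

variable {A B : Type u} [CommRing A] [CommRing B] (f : A →+* B) (I : Ideal A)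

-- Induction on the number of generators: the torsion at one generator is again injective, and
-- that generator acts bijectively on the quotient.
theorem isZero_restrictScalars_of_baer [IsNoetherianRing A] [IsNoetherianRing B]
    (n : ℕ) (s : Finset A) (hs : ∀ a ∈ s, a ∈ I)
    {E : Type u} [AddCommGroup E] [Module B E] (hE : Module.Baer B E)
    (hsE : ∀ e : E, (∀ a ∈ s, e ∈ powTorsion (Ideal.span {f a}) E) →
      ∃ t, ∀ r ∈ I ^ t, f r • e = 0) :
    IsZero ((localCohomology I (n + 1)).obj
      ((ModuleCat.restrictScalars f).obj (ModuleCat.of B E))) := by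
  classical
  induction s using Finset.induction_on generalizing E with
  | empty =>
    exact isZero_of_torsion I n (M := (ModuleCat.restrictScalars f).obj (ModuleCat.of B E))
      (eq_top_iff.2 fun e _ => hsE e (by simp))
  | insert a s _ ih =>
    let N := powTorsion (Ideal.span {f a}) E
    have hN : ∀ e : N, (∀ b ∈ s, e ∈ powTorsion (Ideal.span {f b}) N) →
        ∃ t, ∀ r ∈ I ^ t, f r • e = 0 := fun e he => by
      obtain ⟨t, ht⟩ := hsE e <| (Finset.forall_mem_insert ..).2
        ⟨e.2, fun b hb => (he b hb).imp fun t ht r hr => congrArg Subtype.val (ht r hr)⟩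
      exact ⟨t, fun r hr => Subtype.ext (ht r hr)⟩
    have h₁ := ih (fun b hb => hs b (Finset.mem_insert_of_mem hb)) (baer_powTorsion hE _) hN
    have h₂ : IsZero ((localCohomology I (n + 1)).obj
        ((ModuleCat.restrictScalars f).obj (ModuleCat.of B (E ⧸ N)))) :=
      isZero_of_bijective_smul I (hs a (Finset.mem_insert_self a s))
        (bijective_smul_quotient_powTorsion hE (f a)) _
    exact (((cohomologicalFunctor I).precomp (ModuleCat.restrictScalars f)).exact₂
      (submoduleSeq_shortExact N) (n + 1)).isZero_X₂ (h₁.eq_of_src _ _) (h₂.eq_of_tgt _ _)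

theorem mem_powTorsion_map {E : Type u} [AddCommGroup E] [Module B E] {e : E} :
    e ∈ powTorsion (I.map f) E ↔ ∃ t, ∀ r ∈ I ^ t, f r • e = 0 := by
  refine exists_congr fun t => ?_
  rw [← Ideal.map_pow]
  exact Ideal.map_le_iff_le_comap (K := LinearMap.ker (LinearMap.toSpanSingleton B E e))

theorem effaceable_precomp_restrictScalars [IsNoetherianRing A] [IsNoetherianRing B] :
    ((cohomologicalFunctor I).precomp (ModuleCat.restrictScalars f)).Effaceable := by
  intro n E hE
  obtain ⟨s, hs⟩ := IsNoetherian.noetherian I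
  refine isZero_restrictScalars_of_baer f I n s (fun a ha => hs ▸ Submodule.subset_span ha)
    (baer_of_injective E) fun e he => ?_
  rw [← mem_powTorsion_map, mem_powTorsion_iff_le_radical (IsNoetherian.noetherian _), ← hs,
    Ideal.map_span, Ideal.span_le]
  rintro _ ⟨a, ha, rfl⟩
  exact mem_powTorsion_span_singleton.1 (he a ha)

theorem nonempty_restrictScalars_iso_zero :
    Nonempty (ModuleCat.restrictScalars f ⋙ localCohomology I 0 ≅
      localCohomology (I.map f) 0 ⋙ ModuleCat.restrictScalars f) := by
  let F := ModuleCat.restrictScalars.{u} f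
  refine nonempty_natIso_of_range_eq (H := F)
    (Functor.whiskerLeft F (toSelf I)) (Functor.whiskerRight (toSelf (I.map f)) F)
    (fun M => toSelf_injective I (F.obj M)) (toSelf_injective (I.map f)) fun M => ?_
  ext m
  exact (mem_range_toSelf I (M := F.obj M)).trans
    ((mem_powTorsion_map f I).symm.trans (mem_range_toSelf (I.map f)).symm)

theorem nonempty_restrictScalars_iso [IsNoetherianRing A] [IsNoetherianRing B] (n : ℕ) :
    Nonempty (ModuleCat.restrictScalars f ⋙ localCohomology I n ≅
      localCohomology (I.map f) n ⋙ ModuleCat.restrictScalars f) :=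
  (effaceable_precomp_restrictScalars f I).nonempty_iso
    (S := (cohomologicalFunctor (I.map f)).postcomp (ModuleCat.restrictScalars f))
    (fun n E hE => Functor.map_isZero (ModuleCat.restrictScalars f) (effaceable (I.map f) n E hE))
    (nonempty_restrictScalars_iso_zero f I).some n

theorem mono_map_restrictScalars_map [IsNoetherianRing A] [IsNoetherianRing B] {J : Ideal B}
    (hJ : J.radical = (I.map f).radical) (n : ℕ) {M N : ModuleCat.{u} B} (φ : M ⟶ N)
    [Mono ((localCohomology J n).map φ)] :
    Mono ((localCohomology I n).map ((ModuleCat.restrictScalars f).map φ)) := by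
  obtain ⟨e⟩ := nonempty_restrictScalars_iso f I n
  have := mono_map_of_iso (localCohomology.isoOfSameRadical hJ n) φ
  have : Mono ((localCohomology (I.map f) n ⋙ ModuleCat.restrictScalars f).map φ) :=
    inferInstanceAs (Mono ((ModuleCat.restrictScalars f).map _))
  exact mono_map_of_iso e.symm φ

end BaseChange

end LocalCohomology

namespace FInj

variable {R : Type u} [CommRing R]

section Quotient

variable {a b c : R}

/-- Multiplication by `a`, as a map `R / b R → R / a b R`. The product is a variable `c`, so that
powers of an element need no rewriting. -/
noncomputable def mulQuotientHom (h : c = a * b) :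
    ModuleCat.of R (R ⧸ Ideal.span {b}) ⟶ ModuleCat.of R (R ⧸ Ideal.span {c}) :=
  ModuleCat.ofHom <| Submodule.mapQ _ _ (LinearMap.lsmul R R a) <|
    (Submodule.span_singleton_le_iff_mem _ _).2 (h ▸ Ideal.mem_span_singleton_self _)

theorem mulQuotientHom_comp {a' d e : R} (h : c = a * b) (h' : d = a' * c) (he : e = a' * a)
    (hd : d = e * b) : mulQuotientHom h ≫ mulQuotientHom h' = mulQuotientHom hd := by
  subst he
  exact ModuleCat.hom_ext <| Submodule.linearMap_qext _ <| LinearMap.ext fun r =>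
    congrArg (Ideal.Quotient.mk _) (mul_assoc a' a r).symm

/-- The short complex `R / b R → R / a b R → R / a R`. -/
noncomputable abbrev mulQuotientSeq (h : c = a * b) : ShortComplex (ModuleCat.{u} R) :=
  ShortComplex.mk (mulQuotientHom h)
    (X₃ := ModuleCat.of R (R ⧸ Ideal.span {a})) (ModuleCat.ofHom (Submodule.factor
      (Ideal.span_singleton_le_span_singleton.2 ⟨b, h⟩)))
    (ModuleCat.hom_ext <| Submodule.linearMap_qext _ <| LinearMap.ext fun r =>
      (Ideal.Quotient.eq_zero_iff_dvd a _).2 (dvd_mul_right a r))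

theorem mulQuotientSeq_shortExact (h : c = a * b) (ha : a ∈ nonZeroDivisors R) :
    (mulQuotientSeq h).ShortExact where
  exact := by
    rw [ShortComplex.moduleCat_exact_iff]
    intro (r : R ⧸ Ideal.span {c}) hr
    obtain ⟨r, rfl⟩ := Ideal.Quotient.mk_surjective r
    obtain ⟨s, rfl⟩ := Ideal.mem_span_singleton.1 (Ideal.Quotient.eq_zero_iff_mem.1 hr)
    exact ⟨(Ideal.Quotient.mk _ s : R ⧸ Ideal.span {b}), rfl⟩
  mono_f := by
    rw [ModuleCat.mono_iff_injective, injective_iff_map_eq_zero]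
    intro (r : R ⧸ Ideal.span {b}) hr
    obtain ⟨r, rfl⟩ := Ideal.Quotient.mk_surjective r
    obtain ⟨s, hs⟩ := Ideal.mem_span_singleton.1 (Ideal.Quotient.eq_zero_iff_mem.1 hr)
    rw [Ideal.Quotient.eq_zero_iff_mem, Ideal.mem_span_singleton]
    refine ⟨s, (mul_cancel_left_mem_nonZeroDivisors ha).1 ?_⟩
    rw [← mul_assoc, ← h]
    exact hs
  epi_g := (ModuleCat.epi_iff_surjective _).2 (Submodule.factor_surjective
    (Ideal.span_singleton_le_span_singleton.2 ⟨b, h⟩))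

end Quotient

variable {x : R}

/-- The short complex `R → R → R / x R`, the first map being multiplication by `x`. -/
noncomputable abbrev mulSeq (x : R) : ShortComplex (ModuleCat.{u} R) :=
  ShortComplex.mk (X₃ := ModuleCat.of R (R ⧸ Ideal.span {x}))
    (x • 𝟙 (ModuleCat.of R R)) (ModuleCat.ofHom (Ideal.span {x}).mkQ)
    (ModuleCat.hom_ext (LinearMap.ext fun r =>
      (Ideal.Quotient.eq_zero_iff_dvd x _).2 (dvd_mul_right x r)))

theorem mulSeq_shortExact (hx : x ∈ nonZeroDivisors R) : (mulSeq x).ShortExact where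
  exact := (ShortComplex.moduleCat_exact_iff _).2 fun r hr => by
    obtain ⟨s, rfl⟩ := Ideal.mem_span_singleton.1 (Ideal.Quotient.eq_zero_iff_mem.1 hr)
    exact ⟨s, rfl⟩
  mono_f := (ModuleCat.mono_iff_injective _).2 fun a b h =>
    (mul_cancel_left_mem_nonZeroDivisors hx).1 h
  epi_g := (ModuleCat.epi_iff_surjective _).2 (Submodule.mkQ_surjective _)

theorem mono_map_mulQuotientHom_pow {D : Type u₂} [Category.{v₂} D] [Abelian D]
    (T : CohomologicalFunctor (ModuleCat.{u} R) D) (hx : x ∈ nonZeroDivisors R)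
    (hT : ∀ (ℓ : ℕ) (hℓ : 0 < ℓ) (n : ℕ), Epi ((T.T n).map (quotientPowHom x hℓ))) (t n : ℕ) :
    Mono ((T.T n).map (mulQuotientHom (pow_succ x t))) := by
  induction t with
  | zero =>
    have h : mulQuotientHom (pow_succ x 0) ≫ quotientPowHom x Nat.one_pos = 𝟙 _ :=
      ModuleCat.hom_ext <| Submodule.linearMap_qext _ <| LinearMap.ext fun r =>
        congrArg (Ideal.Quotient.mk _) (show x ^ 0 * r = r by rw [pow_zero, one_mul])
    have : IsSplitMono (mulQuotientHom (pow_succ x 0)) := ⟨⟨⟨_, h⟩⟩⟩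
    infer_instance
  | succ t ih =>
    have hmul : Mono ((T.T n).map (mulQuotientHom (pow_succ' x (t + 1)))) :=
      T.mono_map_f_of_epi_map_g (mulQuotientSeq_shortExact (pow_succ' x (t + 1)) hx)
        (hT _ (t + 1).succ_pos) n
    rw [← mulQuotientHom_comp (pow_succ x t) (pow_succ' x (t + 1)) (pow_succ' x t),
      Functor.map_comp]
    exact mono_comp _ _

theorem injective_δ_mulSeq {A : Type u₁} [CommRing A]
    (T : CohomologicalFunctor (ModuleCat.{u} R) (ModuleCat.{v₁} A)) (hx : x ∈ nonZeroDivisors R)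
    (n : ℕ) (hT : ∀ ξ, ∃ t : ℕ, (T.T n).map (x ^ t • 𝟙 (ModuleCat.of R R)) ξ = 0)
    (hinj : ∀ t, Function.Injective ((T.T n).map (mulQuotientHom (pow_succ x t)))) :
    Function.Injective (T.δ (mulSeq_shortExact hx) n) := by
  rw [injective_iff_map_eq_zero]
  intro ξ hξ
  obtain ⟨η, rfl⟩ := (ShortComplex.moduleCat_exact_iff _).1
    (T.exact₃ (mulSeq_shortExact hx) n) ξ hξ
  obtain ⟨t, ht⟩ := hT η
  let π : ModuleCat.of R R ⟶ ModuleCat.of R (R ⧸ Ideal.span {x ^ (t + 1)}) :=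
    ModuleCat.ofHom (Ideal.span {x ^ (t + 1)}).mkQ
  have h : (T.T n).map (mulSeq x).g ≫ (T.T n).map (mulQuotientHom (pow_succ x t)) =
      (T.T n).map (x ^ t • 𝟙 (ModuleCat.of R R)) ≫ (T.T n).map π := by
    rw [← Functor.map_comp, ← Functor.map_comp]
    rfl
  refine hinj t ((ConcreteCategory.congr_hom h η).trans ?_)
  exact (congrArg ((T.T n).map π) ht).trans ((map_zero _).trans (map_zero _).symm)

section Frobenius

variable (p : ℕ) [Fact p.Prime]

/-- Frobenius pushforward commutes with restriction of scalars. -/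
noncomputable def restrictScalarsFrobeniusIso {S : Type u} [CommRing S] [CharP R p] [CharP S p]
    (f : R →+* S) :
    ModuleCat.restrictScalars.{u} (frobenius S p) ⋙ ModuleCat.restrictScalars f ≅
      ModuleCat.restrictScalars f ⋙ ModuleCat.restrictScalars (frobenius R p) :=
  (ModuleCat.restrictScalarsComp' f (frobenius S p) _ rfl).symm ≪≫
    ModuleCat.restrictScalarsComp' (frobenius R p) f _ (f.frobenius_comm p).symm

variable [CharP R p]

theorem smul_comp_frobeniusHom (r : R) :
    (r • 𝟙 (ModuleCat.of R R)) ≫ frobeniusHom R p = frobeniusHom R p ≫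
      (ModuleCat.restrictScalars (frobenius R p)).map (r ^ p • 𝟙 (ModuleCat.of R R)) :=
  ModuleCat.hom_ext (LinearMap.ext fun s => mul_pow r s p)

variable (x) [CharP (R ⧸ Ideal.span {x}) p]

/-- The Frobenius of `R / x R`, as a map of `R`-modules. -/
noncomputable def quotFrobeniusHom : ModuleCat.of R (R ⧸ Ideal.span {x}) ⟶
    frobeniusPushforward p (ModuleCat.of R (R ⧸ Ideal.span {x})) :=
  (ModuleCat.restrictScalars (Ideal.Quotient.mk (Ideal.span {x}))).map
      (frobeniusHom (R ⧸ Ideal.span {x}) p) ≫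
    (restrictScalarsFrobeniusIso p (Ideal.Quotient.mk (Ideal.span {x}))).hom.app _

/-- The Frobenius as a map of short complexes; since `(x s) ^ p = x (x ^ (p - 1) s ^ p)`, it is
twisted by `x ^ (p - 1)` on the first term. -/
noncomputable def frobeniusSeq : mulSeq x ⟶
    (mulSeq x).map (ModuleCat.restrictScalars (frobenius R p)) where
  τ₁ := frobeniusHom R p ≫ (ModuleCat.restrictScalars (frobenius R p)).map
    (x ^ (p - 1) • 𝟙 (ModuleCat.of R R))
  τ₂ := frobeniusHom R p
  τ₃ := quotFrobeniusHom x p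
  comm₁₂ := by
    refine ModuleCat.hom_ext (LinearMap.ext fun (s : R) => ?_)
    change x * (x ^ (p - 1) * s ^ p) = (x * s) ^ p
    rw [← mul_assoc, mul_pow_sub_one (Fact.out : p.Prime).ne_zero, mul_pow]
  comm₂₃ := rfl

end Frobenius

open LocalCohomology

variable {p : ℕ} [Fact p.Prime] [CharP R p] (J : Ideal R)

theorem radical_map_frobenius : J.radical = (J.map (frobenius R p)).radical := by
  apply le_antisymm
  · exact Ideal.radical_le_radical_iff.2 fun r hr => ⟨p, Ideal.mem_map_of_mem (frobenius R p) hr⟩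
  · exact Ideal.radical_mono <| Ideal.map_le_iff_le_comap.2 fun r hr =>
      Ideal.pow_mem_of_mem _ hr p (Fact.out : p.Prime).pos

variable {J}

theorem exists_pow_map_frobeniusPushforward_eq_zero (hxJ : x ∈ J) (n : ℕ)
    (ξ : (localCohomology J n).obj (frobeniusPushforward p (ModuleCat.of R R))) :
    ∃ t : ℕ, (localCohomology J n).map
      ((ModuleCat.restrictScalars (frobenius R p)).map (x ^ t • 𝟙 (ModuleCat.of R R))) ξ = 0 := by
  obtain ⟨t, ht⟩ := exists_pow_map_smul_eq_zero J n ξ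
  have h : (ModuleCat.restrictScalars (frobenius R p)).map (x ^ (t * p) • 𝟙 (ModuleCat.of R R)) =
      x ^ t • 𝟙 (frobeniusPushforward p (ModuleCat.of R R)) :=
    ModuleCat.hom_ext <| LinearMap.ext fun (s : R) => congrArg (· * s) (pow_mul x t p)
  exact ⟨t * p, h ▸ ht _ (Ideal.pow_mem_pow hxJ t)⟩

theorem injective_δ_frobeniusPushforward_mulSeq [IsNoetherianRing R] (hxJ : x ∈ J)
    (hx : x ∈ nonZeroDivisors R) (hsurj : ∀ (ℓ : ℕ) (hℓ : 0 < ℓ) (n : ℕ), Function.Surjective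
      ((localCohomology J n).map (quotientPowHom x hℓ))) (n : ℕ) :
    Function.Injective (((cohomologicalFunctor J).precomp
      (ModuleCat.restrictScalars (frobenius R p))).δ (mulSeq_shortExact hx) n) := by
  refine injective_δ_mulSeq _ hx n (exists_pow_map_frobeniusPushforward_eq_zero hxJ n) fun t => ?_
  have : Mono ((localCohomology J n).map (mulQuotientHom (pow_succ x t))) :=
    mono_map_mulQuotientHom_pow (cohomologicalFunctor J) hx
      (fun ℓ hℓ n => (ModuleCat.epi_iff_surjective _).2 (hsurj ℓ hℓ n)) t n
  exact (ModuleCat.mono_iff_injective _).1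
    (mono_map_restrictScalars_map (frobenius R p) J (radical_map_frobenius J) n _)

theorem mono_map_quotFrobeniusHom [IsNoetherianRing R] [CharP (R ⧸ Ideal.span {x}) p] (n : ℕ)
    (hF : Function.Injective ((localCohomology (J.map (Ideal.Quotient.mk (Ideal.span {x}))) n).map
      (frobeniusHom (R ⧸ Ideal.span {x}) p))) :
    Mono ((localCohomology J n).map (quotFrobeniusHom x p)) := by
  have := (ModuleCat.mono_iff_injective _).2 hF
  have := mono_map_restrictScalars_map (Ideal.Quotient.mk (Ideal.span {x})) J rfl n
    (frobeniusHom (R ⧸ Ideal.span {x}) p)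
  have h := mono_comp' this (inferInstance : Mono ((localCohomology J n).map
    ((restrictScalarsFrobeniusIso p (Ideal.Quotient.mk (Ideal.span {x}))).hom.app (.of _ _))))
  rwa [← Functor.map_comp] at h

-- By exactness `η = δ ξ`, and naturality of `δ` along `frobeniusSeq` moves the Frobenius to `ξ`.
theorem eq_zero_of_map_smul_of_map_frobeniusHom [CharP (R ⧸ Ideal.span {x}) p]
    (hx : x ∈ nonZeroDivisors R)
    (hδ : ∀ n, Function.Injective (((cohomologicalFunctor J).precomp
      (ModuleCat.restrictScalars (frobenius R p))).δ (mulSeq_shortExact hx) n))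
    (hF : ∀ n, Mono ((localCohomology J n).map (quotFrobeniusHom x p)))
    (n : ℕ) {η : (localCohomology J n).obj (ModuleCat.of R R)}
    (hη : (localCohomology J n).map (x • 𝟙 (ModuleCat.of R R)) η = 0)
    (hη' : (localCohomology J n).map (frobeniusHom R p) η = 0) : η = 0 := by
  let H := cohomologicalFunctor J
  let F := ModuleCat.restrictScalars.{u} (frobenius R p)
  have hS := mulSeq_shortExact hx
  cases n with
  | zero => exact (ModuleCat.mono_iff_injective _).1 (H.mono_zero hS) (hη.trans (map_zero _).symm)
  | succ n =>
    obtain ⟨ξ, rfl⟩ := (ShortComplex.moduleCat_exact_iff _).1 (H.exact₁ hS n) η hη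
    have hτ₁ : (H.T (n + 1)).map (frobeniusSeq x p).τ₁ (H.δ hS n ξ) = 0 := by
      refine (ConcreteCategory.congr_hom ((H.T (n + 1)).map_comp _ _) _).trans ?_
      exact (congrArg ((H.T (n + 1)).map (F.map _)) hη').trans (map_zero _)
    have hδτ₃ : H.δ (hS.map_of_exact F) n ((H.T n).map (quotFrobeniusHom x p) ξ) = 0 :=
      (ConcreteCategory.congr_hom
        (H.δ_naturality hS (hS.map_of_exact F) (frobeniusSeq x p) n) ξ).symm.trans hτ₁
    have hτ₃ : (H.T n).map (quotFrobeniusHom x p) ξ = 0 := hδ n (hδτ₃.trans (map_zero _).symm)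
    have hξ : ξ = 0 := (ModuleCat.mono_iff_injective _).1 (hF n) (hτ₃.trans (map_zero _).symm)
    exact (congrArg (H.δ hS n) hξ).trans (map_zero _)

theorem map_frobeniusHom_map_smul_eq_zero {n : ℕ}
    {η : (localCohomology J n).obj (ModuleCat.of R R)}
    (hη : (localCohomology J n).map (frobeniusHom R p) η = 0) (r : R) :
    (localCohomology J n).map (frobeniusHom R p)
      ((localCohomology J n).map (r • 𝟙 (ModuleCat.of R R)) η) = 0 := by
  have h := ConcreteCategory.congr_hom
    (congrArg (localCohomology J n).map (smul_comp_frobeniusHom p r)) η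
  rw [Functor.map_comp, Functor.map_comp] at h
  exact h.trans ((congrArg ((localCohomology J n).map _) hη).trans (map_zero _))

end FInj

theorem theorem3p5_general {R : Type u} [CommRing R] [IsNoetherianRing R]
    (p : ℕ) [Fact p.Prime] [CharP R p] (J : Ideal R) (x : R) (hxJ : x ∈ J)
    (hreg : x ∈ nonZeroDivisors R) [CharP (R ⧸ Ideal.span {x}) p]
    (hsurj : ∀ (ℓ : ℕ) (hℓ : 0 < ℓ) (i : ℕ), Function.Surjective
      ((localCohomology J i).map (FInj.quotientPowHom x hℓ)))
    (hF : ∀ i : ℕ, Function.Injective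
      ((localCohomology (J.map (Ideal.Quotient.mk (Ideal.span {x}))) i).map
        (FInj.frobeniusHom (R ⧸ Ideal.span {x}) p))) (i : ℕ) :
    Function.Injective ((localCohomology J i).map (FInj.frobeniusHom R p)) := by
  let H := localCohomology J i
  have hsocle {η : H.obj (ModuleCat.of R R)} : H.map (x • 𝟙 _) η = 0 →
      H.map (FInj.frobeniusHom R p) η = 0 → η = 0 :=
    FInj.eq_zero_of_map_smul_of_map_frobeniusHom hreg
      (FInj.injective_δ_frobeniusPushforward_mulSeq hxJ hreg hsurj)
      (fun n => FInj.mono_map_quotFrobeniusHom n (hF n)) i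
  have hpow {η : H.obj (ModuleCat.of R R)} (hη : H.map (FInj.frobeniusHom R p) η = 0) (t : ℕ) :
      H.map (x ^ t • 𝟙 _) η = 0 → η = 0 := by
    induction t with
    | zero => simp
    | succ t ih =>
      intro hη_pow
      have h : x ^ (t + 1) • 𝟙 (ModuleCat.of R R) = (x ^ t • 𝟙 _) ≫ (x • 𝟙 _) := by
        rw [Linear.smul_comp, Linear.comp_smul, Category.comp_id, smul_smul, pow_succ]
      rw [h, Functor.map_comp] at hη_pow
      exact ih (hsocle hη_pow (FInj.map_frobeniusHom_map_smul_eq_zero hη _))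
  refine (injective_iff_map_eq_zero _).2 fun η hη => ?_
  obtain ⟨t, ht⟩ := LocalCohomology.exists_pow_map_smul_eq_zero J i η
  exact hpow hη t (ht _ (Ideal.pow_mem_pow hxJ t))

theorem theorem3p5 {R : Type u} [CommRing R] [IsLocalRing R] [IsNoetherianRing R]
    (p : ℕ) [Fact p.Prime] [CharP R p] (x : R) (hx : x ∈ maximalIdeal R)
    (hreg : x ∈ nonZeroDivisors R)
    (hsurj : ∀ (ℓ : ℕ) (hℓ : 0 < ℓ) (i : ℕ), Function.Surjective
      ((localCohomology (maximalIdeal R) i).map (FInj.quotientPowHom x hℓ)))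
    (hF : haveI := FInj.isLocalRing_quotient hx
      haveI := FInj.charP_quotient p hx
      FInj.IsFInjective (R ⧸ Ideal.span {x}) p) :
    FInj.IsFInjective R p := by
  have := FInj.isLocalRing_quotient hx
  have := FInj.charP_quotient p hx
  exact theorem3p5_general p (maximalIdeal R) x hx hreg hsurj
    ((map_maximalIdeal_of_surjective (Ideal.Quotient.mk (Ideal.span {x}))
      Ideal.Quotient.mk_surjective).symm ▸ hF)
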